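/- Let $\phi:\mathbb{R}^2\to\mathbb{R}$ be locally Lipschitz (for instance $C^1$) and consider the planar system $$\dot x = y,\qquad \dot y = -x-y\,\phi(x,y).$$ For $r\ge 0$ let $D_r=\{p\in\mathbb{R}^2:\operatorname{dist}(p,O)\le r\}$ and $B_r=\{p\in\mathbb{R}^2:\operatorname{dist}(p,O)=r\}$, where $O$ is the origin and $\operatorname{dist}$ is the Euclidean distance. Let $U\subset\mathbb{R}^2$ be bounded and let $\sigma=\sup\{\operatorname{dist}(p,O):p\in U\}$ (with $\sigma=0$ if $U=\emptyset$). Suppose that $\phi\ge 0$ outside $U$ and that, for every $r>\sigma$, $\phi$ does not vanish identically on $B_r$. Then for every $p\in\mathbb{R}^2$ the system has a solution $\gamma:[0,\infty)\to\mathbb{R}^2$ with $\gamma(0)=p$; it is unique, in the sense that every solution on an interval $[0,T)$ starting at $p$ coincides with $\gamma$ there. Moreover: 1. if $\gamma(t_0)\in D_\sigma$ for some $t_0\ge 0$, then $\gamma(t)\in D_\sigma$ for all $t\ge t_0$; 2. for every $\rho>\sigma$ there is $t_0\ge 0$ such that $\gamma(t)\in D_\rho$ for all $t\ge t_0$; 3.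 if $\sigma>0$ and $\phi$ does not vanish identically on $B_\sigma$ either, then there is $t_0\ge 0$ such that $\gamma(t)\in D_\sigma$ for all $t\ge t_0$. -/

import Mathlib

/-- The Euclidean plane; a point `p` has coordinates `x = p 0` and `y = p 1`. -/
abbrev Plane : Type := EuclideanSpace ℝ (Fin 2)

/-- The vector field of the system `x' = y`, `y' = -x - y φ(x, y)`. -/
noncomputable def phiField (φ : Plane → ℝ) (p : Plane) : Plane :=
  !₂[p 1, -p 0 - p 1 * φ p]

/-- `γ` solves `x' = y`, `y' = -x - y φ(x, y)` on the set of times `J`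
(with one-sided derivatives at the endpoints belonging to `J`). -/
def IsSolutionOn (φ : Plane → ℝ) (γ : ℝ → Plane) (J : Set ℝ) : Prop :=
  IsIntegralCurveOn γ (fun _ => phiField φ) J

/-- The closed disk of radius `r` centred at the origin. -/
def disk (r : ℝ) : Set Plane := {p | dist p 0 ≤ r}

/-- The circle of radius `r` centred at the origin. -/
def circleB (r : ℝ) : Set Plane := {p | dist p 0 = r}

/-- `φ` vanishes identically on the circle of radius `r`. -/
def VanishesOnCircle (φ : Plane → ℝ) (r : ℝ) : Prop := ∀ p ∈ circleB r, φ p = 0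

/-!
The squared distance to the origin is a Lyapunov function: along a solution
`d/dt ‖γ‖² = -2 y² φ(γ)`, and by continuity `φ ≥ 0` on all of `‖p‖ ≥ σ` (except possibly at the
origin, where `y² φ = 0` anyway). Hence every disk of radius at least `σ` is positively invariant
(`norm_le_of_inner_nonpos`). This also gives global existence (`exists_isSolutionOn_Ici`): multiplied
by a bump function that is `1` on a large invariant disk, the field becomes bounded, so
Picard-Lindelöf applies on every interval `[0, n]`, and its solution never sees the cutoff.

It remains to show that an orbit cannot stay outside the open disk of radius `c > 0` when `φ`
vanishes identically on no circle of radius at least `c` (`IsSolutionOn.exists_norm_lt`). Instead of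
LaSalle's principle a quantitative argument is used. In complex notation the system is
`z' = -i z - i y φ`, and if `0 ≤ φ ≤ M` along the orbit then `|y φ| ≤ ε + (M / ε) y² φ`, so that
between times `s` and `t` the orbit deviates from the rotation `e^{-i(t-s)} z(s)` by at most
`ε (t - s)` plus a multiple of the energy lost (`IsSolutionOn.norm_sub_rotation_le`). If the orbit
stayed outside, its radius would decrease to some `R ≥ c`; late enough, one turn of the orbit would
then follow the circle of radius `R` closely and meet a neighbourhood of a point of that circle with
`y² φ > 0`, where it loses a fixed amount of energy, more than is left.
-/

open Set Filter Topology
open scoped NNReal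

/-! ### Integral curves of locally Lipschitz fields -/

section GeneralFields

variable {E : Type*} [NormedAddCommGroup E] [NormedSpace ℝ E]

/-- Two integral curves of a locally Lipschitz field with the same initial point agree: on a
compact time interval both stay in a compact set, on which the field is Lipschitz. -/
theorem eqOn_Icc_of_locallyLipschitz {v : E → E} (hv : LocallyLipschitz v) {f g : ℝ → E} {a b : ℝ}
    (hf : IsIntegralCurveOn f (fun _ => v) (Icc a b))
    (hg : IsIntegralCurveOn g (fun _ => v) (Icc a b)) (h : f a = g a) :
    EqOn f g (Icc a b) := by
  have hc : IsCompact (f '' Icc a b ∪ g '' Icc a b) :=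
    (isCompact_Icc.image_of_continuousOn hf.continuousOn).union
      (isCompact_Icc.image_of_continuousOn hg.continuousOn)
  obtain ⟨K, hK⟩ := (hv.locallyLipschitzOn).exists_lipschitzOnWith_of_compact hc
  have key : ∀ {k : ℝ → E}, IsIntegralCurveOn k (fun _ => v) (Icc a b) →
      ∀ t ∈ Ico a b, HasDerivWithinAt k (v (k t)) (Ici t) t := fun hk t ht =>
    (hk t (Ico_subset_Icc_self ht)).mono_of_mem_nhdsWithin (Icc_mem_nhdsGE_of_mem ht)
  exact ODE_solution_unique_of_mem_Icc_right (v := fun _ => v)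
    (s := fun _ => f '' Icc a b ∪ g '' Icc a b) (K := K) (fun _ _ => hK)
    hf.continuousOn (key hf) (fun t ht => Or.inl (mem_image_of_mem _ (Ico_subset_Icc_self ht)))
    hg.continuousOn (key hg) (fun t ht => Or.inr (mem_image_of_mem _ (Ico_subset_Icc_self ht))) h

/-- A curve that starts in a ball centred at the origin stays in it if the field does not point
outwards at any point outside or on the boundary of the ball. -/
theorem norm_le_of_inner_nonpos {F : Type*} [NormedAddCommGroup F] [InnerProductSpace ℝ F]
    {v : F → F} {γ : ℝ → F} {a b c : ℝ} (hγ : IsIntegralCurveOn γ (fun _ => v) (Icc a b))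
    (hc : 0 ≤ c) (hv : ∀ p, c ≤ ‖p‖ → inner ℝ p (v p) ≤ 0) (ha : ‖γ a‖ ≤ c) :
    ∀ t ∈ Icc a b, ‖γ t‖ ≤ c := by
  intro t ht
  have hd : ∀ s ∈ Icc a b,
      HasDerivWithinAt (fun s => ‖γ s‖ ^ 2) (2 * inner ℝ (γ s) (v (γ s))) (Icc a b) s :=
    fun s hs => (hγ s hs).norm_sq
  refine (sq_le_sq₀ (norm_nonneg _) hc).1 ?_
  -- Compare with a barrier of slope `ε > 0`, which the squared norm can only cross downwards.
  have hε : ∀ ε > 0, ‖γ t‖ ^ 2 ≤ c ^ 2 + ε * (t - a) := by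
    intro ε hε
    refine image_le_of_deriv_right_lt_deriv_boundary (f := fun s => ‖γ s‖ ^ 2)
      (f' := fun s => 2 * inner ℝ (γ s) (v (γ s))) (B := fun s => c ^ 2 + ε * (s - a))
      (B' := fun _ => ε) (fun s hs => (hd s hs).continuousWithinAt)
      (fun s hs => (hd s (Ico_subset_Icc_self hs)).mono_of_mem_nhdsWithin
        (Icc_mem_nhdsGE_of_mem hs)) ?_ ?_ ?_ ht
    · simpa using pow_le_pow_left₀ (norm_nonneg _) ha 2
    · intro s
      simpa using (((hasDerivAt_id s).sub_const a).const_mul ε).const_add (c ^ 2)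
    · intro s hs h
      have : c ≤ ‖γ s‖ := by
        refine (sq_le_sq₀ hc (norm_nonneg _)).1 ?_
        have := mul_nonneg hε.le (sub_nonneg.2 hs.1)
        linarith [h]
      linarith [hv _ this]
  have hlim : Tendsto (fun ε : ℝ => c ^ 2 + ε * (t - a)) (𝓝[>] 0) (𝓝 (c ^ 2)) :=
    (Continuous.tendsto' (by fun_prop) 0 (c ^ 2) (by simp)).mono_left nhdsWithin_le_nhds
  exact ge_of_tendsto hlim (eventually_mem_nhdsWithin.mono fun ε h => hε ε h)

/-- Integral curves on all the intervals `[0, n]` glue, by uniqueness, to one on `[0, ∞)`. -/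
theorem exists_isIntegralCurveOn_Ici {v : E → E} (hv : LocallyLipschitz v) {x : E}
    (h : ∀ n : ℕ, ∃ γ : ℝ → E, γ 0 = x ∧ IsIntegralCurveOn γ (fun _ => v) (Icc 0 n)) :
    ∃ γ : ℝ → E, γ 0 = x ∧ IsIntegralCurveOn γ (fun _ => v) (Ici 0) := by
  choose c hc0 hc using h
  have hcompat : ∀ m n : ℕ, m ≤ n → EqOn (c m) (c n) (Icc 0 m) := fun m n hmn =>
    eqOn_Icc_of_locallyLipschitz hv (hc m)
      ((hc n).mono (Icc_subset_Icc_right (by exact_mod_cast hmn))) ((hc0 m).trans (hc0 n).symm)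
  have heq : ∀ n : ℕ, EqOn (fun t => c ⌈t⌉₊ t) (c n) (Icc 0 n) := fun n t ht =>
    hcompat _ _ (Nat.ceil_le.2 ht.2) ⟨ht.1, Nat.le_ceil t⟩
  refine ⟨fun t => c ⌈t⌉₊ t, by simp [hc0], fun t (ht : 0 ≤ t) => ?_⟩
  have hlt : t < (⌈t⌉₊ + 1 : ℕ) := by
    push_cast
    linarith [Nat.le_ceil t]
  have hmem : t ∈ Icc (0 : ℝ) (⌈t⌉₊ + 1 : ℕ) := ⟨ht, hlt.le⟩
  have hd := ((hc _) t hmem).congr (heq _) (heq _ hmem)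
  rw [← heq _ hmem] at hd
  refine hd.mono_of_mem_nhdsWithin ?_
  exact mem_of_superset (inter_mem_nhdsWithin _ (Iio_mem_nhds hlt)) fun s hs => ⟨hs.1, hs.2.le⟩

/-- A bounded locally Lipschitz field has integral curves defined on arbitrarily long time
intervals. -/
theorem exists_isIntegralCurveOn_Icc_of_bounded [ProperSpace E] [CompleteSpace E] {v : E → E}
    (hv : LocallyLipschitz v) {C : ℝ} (hC : ∀ p, ‖v p‖ ≤ C) (x : E) {T : ℝ} (hT : 0 ≤ T) :
    ∃ γ : ℝ → E, γ 0 = x ∧ IsIntegralCurveOn γ (fun _ => v) (Icc 0 T) := by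
  have hC0 : 0 ≤ C := (norm_nonneg _).trans (hC x)
  lift C to ℝ≥0 using hC0
  lift T to ℝ≥0 using hT
  obtain ⟨K, hK⟩ := (hv.locallyLipschitzOn).exists_lipschitzOnWith_of_compact
    (isCompact_closedBall x (C * T : ℝ≥0))
  have hpl : IsPicardLindelof (fun _ => v) (⟨0, le_rfl, T.2⟩ : Icc (0 : ℝ) T) x (C * T) 0 C K :=
    { lipschitzOnWith := fun _ _ => hK
      continuousOn := fun _ _ => continuousOn_const
      norm_le := fun _ _ p _ => hC p
      mul_max_le := by simp }
  exact hpl.exists_eq_forall_mem_Icc_hasDerivWithinAt₀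

end GeneralFields

/-! ### Global existence -/

section Field

theorem ContDiff.locallyLipschitz_graph {φ : Plane → ℝ} {G : Plane × ℝ → Plane}
    (hG : ContDiff ℝ 1 G) (hφ : LocallyLipschitz φ) : LocallyLipschitz (fun p => G (p, φ p)) :=
  hG.locallyLipschitz.comp (LocallyLipschitz.id.prodMk hφ)

theorem locallyLipschitz_smul_phiField {φ : Plane → ℝ} (hφ : LocallyLipschitz φ) {χ : Plane → ℝ}
    (hχ : ContDiff ℝ 1 χ) : LocallyLipschitz (fun p => χ p • phiField φ p) := by
  have hcoord : ∀ i : Fin 2, ContDiff ℝ 1 (fun z : Plane × ℝ => z.1 i) := fun i =>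
    (EuclideanSpace.proj i : Plane →L[ℝ] ℝ).contDiff.comp contDiff_fst
  have hF : ContDiff ℝ 1 (fun z : Plane × ℝ => (!₂[z.1 1, -z.1 0 - z.1 1 * z.2] : Plane)) := by
    refine contDiff_euclidean.2 (Fin.forall_fin_two.2 ⟨hcoord 1, ?_⟩)
    exact (hcoord 0).neg.sub ((hcoord 1).mul contDiff_snd)
  have hG : ContDiff ℝ 1 (fun z : Plane × ℝ =>
      χ z.1 • (!₂[z.1 1, -z.1 0 - z.1 1 * z.2] : Plane)) := (hχ.comp contDiff_fst).smul hF
  have h := hG.locallyLipschitz_graph hφ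
  unfold phiField
  exact h

theorem locallyLipschitz_phiField {φ : Plane → ℝ} (hφ : LocallyLipschitz φ) :
    LocallyLipschitz (phiField φ) := by
  simpa using locallyLipschitz_smul_phiField hφ (χ := fun _ => 1) contDiff_const

theorem inner_phiField (φ : Plane → ℝ) (p : Plane) :
    inner ℝ p (phiField φ p) = -(p 1 ^ 2 * φ p) := by
  simp [phiField, PiLp.inner_apply, Fin.sum_univ_two]
  ring

/-- Outside a disk on whose exterior `φ ≥ 0`, orbits do not move outwards; hence cutting the field
off far away does not change the orbit of a given point, and makes it exist for all times. -/
theorem exists_isSolutionOn_Ici {φ : Plane → ℝ} (hφ : LocallyLipschitz φ) {σ : ℝ}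
    (hpos : ∀ p : Plane, σ < ‖p‖ → 0 ≤ φ p) (p : Plane) :
    ∃ γ : ℝ → Plane, γ 0 = p ∧ IsSolutionOn φ γ (Ici 0) := by
  obtain ⟨r, hr0, hσr, hpr⟩ : ∃ r : ℝ, 0 < r ∧ σ < r ∧ ‖p‖ ≤ r :=
    ⟨max (‖p‖ + 1) (σ + 1), lt_max_of_lt_left (by positivity), lt_max_of_lt_right (by linarith),
      le_max_of_le_left (by linarith)⟩
  let χ : ContDiffBump (0 : Plane) := ⟨r, r + 1, hr0, by linarith⟩
  have hlip := locallyLipschitz_smul_phiField hφ (χ := χ) χ.contDiff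
  obtain ⟨C, hC⟩ := (χ.hasCompactSupport.smul_right (f' := phiField φ)).exists_bound_of_continuous
    hlip.continuous
  refine exists_isIntegralCurveOn_Ici (locallyLipschitz_phiField hφ) fun n => ?_
  obtain ⟨γ, h0, hγ⟩ := exists_isIntegralCurveOn_Icc_of_bounded hlip hC p n.cast_nonneg
  refine ⟨γ, h0, fun t ht => ?_⟩
  have hle : ‖γ t‖ ≤ r := by
    refine norm_le_of_inner_nonpos hγ hr0.le (fun q hq => ?_) (h0 ▸ hpr) t ht
    rw [inner_smul_right, inner_phiField]
    exact mul_nonpos_of_nonneg_of_nonpos χ.nonneg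
      (neg_nonpos.2 (mul_nonneg (sq_nonneg _) (hpos q (hσr.trans_le hq))))
  have h1 : χ (γ t) = 1 := χ.one_of_mem_closedBall (by simpa [χ] using hle)
  simpa [h1] using hγ t ht

end Field

/-! ### Comparison with the rotation -/

section Rotation

/-- The plane as `ℂ`, via `p ↦ x + i y`. -/
noncomputable def planeToComplex : Plane ≃ₗᵢ[ℝ] ℂ := Complex.orthonormalBasisOneI.repr.symm

theorem planeToComplex_apply (p : Plane) : planeToComplex p = p 0 + p 1 * Complex.I :=
  Complex.orthonormalBasisOneI_repr_symm_apply p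

/-- In complex notation the system is the clockwise rotation `z' = -i z` perturbed by the
friction `-i y φ`. -/
theorem planeToComplex_phiField (φ : Plane → ℝ) (p : Plane) :
    planeToComplex (phiField φ p) =
      -Complex.I * planeToComplex p - Complex.I * ((p 1 * φ p : ℝ) : ℂ) := by
  simp only [planeToComplex_apply, phiField]
  apply Complex.ext <;> simp

theorem IsSolutionOn.hasDerivWithinAt_norm_sq {φ : Plane → ℝ} {γ : ℝ → Plane} {J : Set ℝ}
    (hγ : IsSolutionOn φ γ J) {t : ℝ} (ht : t ∈ J) :
    HasDerivWithinAt (fun s => ‖γ s‖ ^ 2) (-2 * (γ t 1 ^ 2 * φ (γ t))) J t := by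
  have h := (hγ t ht).norm_sq
  rw [inner_phiField] at h
  convert h using 1
  ring

theorem abs_mul_le_add_div_mul {y f M ε : ℝ} (hf : 0 ≤ f) (hfM : f ≤ M) (hε : 0 < ε) :
    |y * f| ≤ ε + M / ε * (y ^ 2 * f) := by
  have h1 : |y * f| * ε ≤ ε ^ 2 + |y * f| ^ 2 := by nlinarith [sq_nonneg (|y * f| - ε)]
  have h2 : |y * f| ^ 2 ≤ M * (y ^ 2 * f) := by
    rw [sq_abs]
    nlinarith [mul_nonneg (mul_nonneg (sq_nonneg y) hf) (sub_nonneg.2 hfM)]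
  have h3 : ε + M / ε * (y ^ 2 * f) = (ε ^ 2 + M * (y ^ 2 * f)) / ε := by
    field_simp
  rw [h3, le_div_iff₀ hε]
  linarith

/-- Along a solution with `0 ≤ φ ≤ M`, the deviation from the clockwise rotation is controlled by
the elapsed time, with an arbitrarily small factor `ε`, and the loss of energy. -/
theorem IsSolutionOn.norm_sub_rotation_le {φ : Plane → ℝ} {γ : ℝ → Plane} {s t M ε : ℝ}
    (hγ : IsSolutionOn φ γ (Icc s t)) (hst : s ≤ t)
    (h0 : ∀ u ∈ Icc s t, 0 ≤ φ (γ u)) (hM : ∀ u ∈ Icc s t, φ (γ u) ≤ M) (hε : 0 < ε) :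
    ‖planeToComplex (γ t) - Complex.exp ((s - t : ℝ) * Complex.I) * planeToComplex (γ s)‖ ≤
      ε * (t - s) + M / (2 * ε) * (‖γ s‖ ^ 2 - ‖γ t‖ ^ 2) := by
  -- In the rotating frame only the friction term is left, and `|y φ| ≤ ε + (M / ε) y² φ`.
  set w : ℝ → ℂ := fun u => Complex.exp (((u - t : ℝ) : ℂ) * Complex.I) * planeToComplex (γ u)
  have hw : ∀ u ∈ Icc s t, HasDerivWithinAt w (Complex.exp (((u - t : ℝ) : ℂ) * Complex.I) *
      (-Complex.I * ((γ u 1 * φ (γ u) : ℝ) : ℂ))) (Icc s t) u := by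
    intro u hu
    have h1 : HasDerivAt (fun u : ℝ => Complex.exp (((u - t : ℝ) : ℂ) * Complex.I))
        (Complex.exp (((u - t : ℝ) : ℂ) * Complex.I) * (((1 : ℝ) : ℂ) * Complex.I)) u :=
      ((((hasDerivAt_id u).sub_const t).ofReal_comp).mul_const Complex.I).cexp
    have h2 : HasDerivWithinAt (fun u => planeToComplex (γ u))
        (planeToComplex (phiField φ (γ u))) (Icc s t) u :=
      planeToComplex.toContinuousLinearEquiv.toContinuousLinearMap.hasFDerivAt
        |>.comp_hasDerivWithinAt u (hγ u hu)
    refine (h1.hasDerivWithinAt.mul h2).congr_deriv ?_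
    rw [planeToComplex_phiField]
    push_cast
    ring
  have hE : ∀ u ∈ Icc s t, HasDerivWithinAt
      (fun u => ε * (u - s) + M / (2 * ε) * (‖γ s‖ ^ 2 - ‖γ u‖ ^ 2))
      (ε + M / ε * (γ u 1 ^ 2 * φ (γ u))) (Icc s t) u := by
    intro u hu
    refine ((((hasDerivAt_id u).sub_const s).const_mul ε).hasDerivWithinAt.add
      (((hγ.hasDerivWithinAt_norm_sq hu).const_sub (‖γ s‖ ^ 2)).const_mul (M / (2 * ε)))).congr_deriv
        ?_
    ring
  have hnhds : ∀ u ∈ Ico s t, Icc s t ∈ 𝓝[≥] u := fun u hu => Icc_mem_nhdsGE_of_mem hu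
  have key := image_norm_le_of_norm_deriv_right_le_deriv_boundary' (f := fun u => w u - w s)
    (fun u hu => ((hw u hu).sub_const _).continuousWithinAt)
    (fun u hu => ((hw u (Ico_subset_Icc_self hu)).sub_const _).mono_of_mem_nhdsWithin (hnhds u hu))
    (B := fun u => ε * (u - s) + M / (2 * ε) * (‖γ s‖ ^ 2 - ‖γ u‖ ^ 2)) (by simp)
    (fun u hu => (hE u hu).continuousWithinAt)
    (fun u hu => (hE u (Ico_subset_Icc_self hu)).mono_of_mem_nhdsWithin (hnhds u hu))
    (fun u hu => by
      rw [norm_mul, Complex.norm_exp_ofReal_mul_I, one_mul, norm_mul, norm_neg, Complex.norm_I,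
        one_mul, Complex.norm_real, Real.norm_eq_abs]
      exact abs_mul_le_add_div_mul (h0 u (Ico_subset_Icc_self hu)) (hM u (Ico_subset_Icc_self hu))
        hε) (right_mem_Icc.2 hst)
  simpa [w] using key

/-- Within one turn of the clockwise rotation, every point reaches every direction. -/
theorem exists_rotation_eq (z : ℂ) {q : ℂ} (hq : q ≠ 0) :
    ∃ h ∈ Icc 0 (2 * Real.pi),
      Complex.exp ((-h : ℝ) * Complex.I) * z = ((‖z‖ / ‖q‖ : ℝ) : ℂ) * q := by
  have key : ∀ h : ℝ, Complex.exp (h * Complex.I) = Complex.exp ((z / q).arg * Complex.I) →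
      Complex.exp ((-h : ℝ) * Complex.I) * z = ((‖z‖ / ‖q‖ : ℝ) : ℂ) * q := by
    intro h hh
    have h1 : ((‖z‖ / ‖q‖ : ℝ) : ℂ) * Complex.exp (h * Complex.I) = z / q := by
      rw [hh, ← norm_div, Complex.norm_mul_exp_arg_mul_I]
    have h2 : z = ((‖z‖ / ‖q‖ : ℝ) : ℂ) * Complex.exp (h * Complex.I) * q := by
      rw [h1, div_mul_cancel₀ _ hq]
    have h3 : Complex.exp ((-h : ℝ) * Complex.I) * Complex.exp (h * Complex.I) = 1 := by
      rw [← Complex.exp_add]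
      simp
    calc Complex.exp ((-h : ℝ) * Complex.I) * z
        = Complex.exp ((-h : ℝ) * Complex.I) *
          (((‖z‖ / ‖q‖ : ℝ) : ℂ) * Complex.exp (h * Complex.I) * q) := by rw [← h2]
      _ = (Complex.exp ((-h : ℝ) * Complex.I) * Complex.exp (h * Complex.I)) *
          (((‖z‖ / ‖q‖ : ℝ) : ℂ) * q) := by ring
      _ = _ := by rw [h3, one_mul]
  have h1 := Complex.neg_pi_lt_arg (z / q)
  have h2 := Complex.arg_le_pi (z / q)
  rcases le_or_gt 0 (z / q).arg with h | h
  · exact ⟨_, ⟨h, by linarith⟩, key _ rfl⟩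
  · refine ⟨(z / q).arg + 2 * Real.pi, ⟨by linarith, by linarith⟩, key _ ?_⟩
    push_cast
    rw [add_mul, Complex.exp_add, Complex.exp_two_pi_mul_I, mul_one]

theorem exists_norm_eq_pos_of_coord_ne_zero {φ : Plane → ℝ} (hφ : Continuous φ) {p : Plane}
    (hp : p ≠ 0) (hpos : 0 < φ p) : ∃ q : Plane, ‖q‖ = ‖p‖ ∧ 0 < φ q ∧ q 1 ≠ 0 := by
  by_cases h1 : p 1 = 0
  · have h0 : p 0 ≠ 0 := fun h0 => hp <| by
      ext i
      fin_cases i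
      exacts [h0, h1]
    -- Turn `p`, which lies on the `x`-axis, by a small angle.
    let f : ℝ → Plane := fun θ => !₂[p 0 * Real.cos θ, p 0 * Real.sin θ]
    have hf : Continuous f := by fun_prop
    have hf0 : f 0 = p := by
      ext i
      fin_cases i <;> simp [f, h1]
    have hev : ∀ᶠ θ in 𝓝[>] (0 : ℝ), 0 < φ (f θ) :=
      nhdsWithin_le_nhds (((hφ.comp hf).tendsto 0).eventually_const_lt (by simpa [hf0] using hpos))
    obtain ⟨θ, hθ, hθ'⟩ := (hev.and (Ioo_mem_nhdsGT Real.pi_pos)).exists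
    refine ⟨f θ, ?_, hθ, mul_ne_zero h0 (Real.sin_pos_of_mem_Ioo hθ').ne'⟩
    rw [← sq_eq_sq₀ (norm_nonneg _) (norm_nonneg _), EuclideanSpace.real_norm_sq_eq,
      EuclideanSpace.real_norm_sq_eq]
    simp only [Fin.sum_univ_two, h1, f]
    simp
    linear_combination p 0 ^ 2 * Real.sin_sq_add_cos_sq θ
  · exact ⟨p, rfl, hpos, h1⟩

end Rotation

/-! ### Loss of energy along orbits -/

section Dissipation

theorem IsSolutionOn.norm_le {φ : Plane → ℝ} {γ : ℝ → Plane} {a b c : ℝ}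
    (hγ : IsSolutionOn φ γ (Icc a b)) (hc : 0 ≤ c)
    (hpos : ∀ p : Plane, p ≠ 0 → c ≤ ‖p‖ → 0 ≤ φ p) (ha : ‖γ a‖ ≤ c) :
    ∀ t ∈ Icc a b, ‖γ t‖ ≤ c := by
  refine norm_le_of_inner_nonpos hγ hc (fun p hp => ?_) ha
  rw [inner_phiField, neg_nonpos]
  by_cases h : p = 0
  · simp [h]
  · exact mul_nonneg (sq_nonneg _) (hpos p h hp)

/-- If `φ ≥ 0` outside the open disk of radius `c > 0` and `φ` vanishes identically on no circle
of radius at least `c`, then every solution enters the open disk of radius `c`.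

Otherwise `‖γ‖²` decreases to some `L = R² ≥ c²`. Once the remaining energy is small, the orbit
follows the rotation for a whole turn, so it passes close to a point `q` of the circle of radius
`R` at which `y² φ > 0`. It stays near `q` for a time `τ` that does not depend on the turn, and
loses there more energy than is left. -/
theorem IsSolutionOn.exists_norm_lt {φ : Plane → ℝ} {γ : ℝ → Plane} {c : ℝ}
    (hφ : Continuous φ) (hF : Continuous (phiField φ)) (hγ : IsSolutionOn φ γ (Ici 0))
    (hc : 0 < c) (hpos : ∀ p : Plane, c ≤ ‖p‖ → 0 ≤ φ p)
    (hcirc : ∀ r, c ≤ r → ¬ VanishesOnCircle φ r) : ∃ t, 0 ≤ t ∧ ‖γ t‖ < c := by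
  by_contra! hout
  have hφγ : ∀ t, 0 ≤ t → 0 ≤ φ (γ t) := fun t ht => hpos _ (hout t ht)
  have hanti : AntitoneOn (fun t => ‖γ t‖ ^ 2) (Ici 0) :=
    antitoneOn_of_hasDerivWithinAt_nonpos (convex_Ici 0)
      (fun t ht => (hγ.hasDerivWithinAt_norm_sq ht).continuousWithinAt)
      (fun t ht => (hγ.hasDerivWithinAt_norm_sq (interior_subset ht)).mono interior_subset)
      (fun t ht => by
        have := mul_nonneg (sq_nonneg (γ t 1)) (hφγ t (interior_subset ht))
        linarith)
  have hball : ∀ t, 0 ≤ t → γ t ∈ Metric.closedBall (0 : Plane) ‖γ 0‖ := fun t ht => by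
    rw [mem_closedBall_zero_iff]
    exact (sq_le_sq₀ (norm_nonneg _) (norm_nonneg _)).1 (hanti self_mem_Ici ht ht)
  -- The limit radius `R`.
  set L := sInf ((fun t => ‖γ t‖ ^ 2) '' Ici 0)
  have hne : ((fun t => ‖γ t‖ ^ 2) '' Ici (0 : ℝ)).Nonempty := nonempty_Ici.image _
  have hLle : ∀ t, 0 ≤ t → L ≤ ‖γ t‖ ^ 2 := fun t ht =>
    csInf_le ⟨0, by rintro _ ⟨s, -, rfl⟩; positivity⟩ (mem_image_of_mem _ ht)
  have hcL : c ^ 2 ≤ L := le_csInf hne (by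
    rintro _ ⟨s, hs, rfl⟩
    exact pow_le_pow_left₀ hc.le (hout s hs) 2)
  obtain ⟨R, hcR, hRL⟩ : ∃ R, c ≤ R ∧ R ^ 2 = L :=
    ⟨√L, Real.le_sqrt_of_sq_le hcL, Real.sq_sqrt ((sq_nonneg c).trans hcL)⟩
  have hR : 0 < R := hc.trans_le hcR
  -- A point of the limit circle at which energy is lost.
  obtain ⟨q, hqR, hq⟩ : ∃ q : Plane, ‖q‖ = R ∧ 0 < q 1 ^ 2 * φ q := by
    obtain ⟨p, hp, hp0⟩ : ∃ p : Plane, ‖p‖ = R ∧ φ p ≠ 0 := by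
      simpa [VanishesOnCircle, circleB] using hcirc R hcR
    obtain ⟨q, hqp, hq, hq1⟩ := exists_norm_eq_pos_of_coord_ne_zero hφ
      (norm_pos_iff.1 (hp ▸ hR)) ((hpos p (hp ▸ hcR)).lt_of_ne' hp0)
    exact ⟨q, hqp.trans hp, mul_pos (by positivity) hq⟩
  obtain ⟨δ, hδ, hδq⟩ : ∃ δ > 0, ∀ p, dist p q < δ → q 1 ^ 2 * φ q / 2 < p 1 ^ 2 * φ p :=
    Metric.eventually_nhds_iff.1 (((by fun_prop : Continuous fun p : Plane => p 1 ^ 2 * φ p).tendsto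
      q).eventually_const_lt (half_lt_self hq))
  set η := q 1 ^ 2 * φ q / 2
  have hη0 : 0 < η := half_pos hq
  -- Bounds for `φ` and for the speed along the orbit.
  obtain ⟨M, hM0, hM⟩ : ∃ M, 0 < M ∧ ∀ t, 0 ≤ t → φ (γ t) ≤ M := by
    obtain ⟨M, hM⟩ := (isCompact_closedBall (0 : Plane) ‖γ 0‖).exists_bound_of_continuousOn
      hφ.continuousOn
    exact ⟨max M 1, by positivity, fun t ht =>
      ((le_abs_self _).trans (hM _ (hball t ht))).trans (le_max_left _ _)⟩
  obtain ⟨K, hK0, hK⟩ : ∃ K, 0 < K ∧ ∀ t, 0 ≤ t → ‖phiField φ (γ t)‖ ≤ K := by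
    obtain ⟨K, hK⟩ := (isCompact_closedBall (0 : Plane) ‖γ 0‖).exists_bound_of_continuousOn
      hF.continuousOn
    exact ⟨max K 1, by positivity, fun t ht => (hK _ (hball t ht)).trans (le_max_left _ _)⟩
  have hπ := Real.pi_pos
  obtain ⟨τ, hτ0, hτ⟩ : ∃ τ, 0 < τ ∧ K * τ = δ / 4 :=
    ⟨δ / 4 / K, by positivity, mul_div_cancel₀ _ hK0.ne'⟩
  obtain ⟨ε, hε0, hε⟩ : ∃ ε, 0 < ε ∧ ε * (2 * Real.pi) = δ / 8 :=
    ⟨δ / 8 / (2 * Real.pi), by positivity, div_mul_cancel₀ _ (by positivity)⟩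
  obtain ⟨κ, hκ0, hκη, hκR, hκM⟩ :
      ∃ κ, 0 < κ ∧ κ ≤ η * τ ∧ κ ≤ δ / 8 * R ∧ M / (2 * ε) * κ ≤ δ / 8 := by
    refine ⟨min (η * τ) (min (δ / 8 * R) (δ / 8 / (M / (2 * ε)))), by positivity, min_le_left _ _,
      (min_le_right _ _).trans (min_le_left _ _), ?_⟩
    rw [← le_div_iff₀' (by positivity)]
    exact (min_le_right _ _).trans (min_le_right _ _)
  -- A time `T` at which the energy still to be lost is less than `κ`.
  obtain ⟨_, ⟨T, hT, rfl⟩, hTκ⟩ := exists_lt_of_csInf_lt hne (lt_add_of_pos_right L hκ0)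
  replace hT : 0 ≤ T := hT
  replace hTκ : ‖γ T‖ ^ 2 < L + κ := hTκ
  -- The time `s` within the next turn at which the orbit is close to `q`.
  have hq0 : planeToComplex q ≠ 0 := by
    rw [← norm_pos_iff, LinearIsometryEquiv.norm_map, hqR]
    exact hR
  obtain ⟨h, ⟨h0, hh⟩, hrot⟩ := exists_rotation_eq (planeToComplex (γ T)) hq0
  rw [LinearIsometryEquiv.norm_map, LinearIsometryEquiv.norm_map, hqR] at hrot
  have hs : 0 ≤ T + h := by positivity
  have hsub : ∀ {a b : ℝ}, 0 ≤ a → Icc a b ⊆ Ici 0 := fun ha x hx => ha.trans hx.1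
  have d1 : ‖planeToComplex (γ (T + h)) - ((‖γ T‖ / R : ℝ) : ℂ) * planeToComplex q‖ ≤ δ / 4 := by
    have hturn : IsSolutionOn φ γ (Icc T (T + h)) := hγ.mono (hsub hT)
    have := hturn.norm_sub_rotation_le (by linarith)
      (fun u hu => hφγ u (hsub hT hu)) (fun u hu => hM u (hsub hT hu)) hε0
    rw [show T - (T + h) = -h by ring, hrot, add_sub_cancel_left] at this
    have e1 : ε * h ≤ δ / 8 := hε ▸ mul_le_mul_of_nonneg_left hh hε0.le
    have e2 : M / (2 * ε) * (‖γ T‖ ^ 2 - ‖γ (T + h)‖ ^ 2) ≤ δ / 8 :=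
      (mul_le_mul_of_nonneg_left (by linarith [hLle _ hs]) (by positivity)).trans hκM
    linarith
  have d2 : ‖((‖γ T‖ / R : ℝ) : ℂ) * planeToComplex q - planeToComplex q‖ ≤ δ / 8 := by
    have hRT : R ≤ ‖γ T‖ := by
      rw [← sq_le_sq₀ hR.le (norm_nonneg _), hRL]
      exact hLle T hT
    have e : ((‖γ T‖ / R : ℝ) : ℂ) * planeToComplex q - planeToComplex q =
        ((‖γ T‖ / R - 1 : ℝ) : ℂ) * planeToComplex q := by
      push_cast
      ring
    rw [e, norm_mul, Complex.norm_real, LinearIsometryEquiv.norm_map, hqR, Real.norm_eq_abs,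
      abs_of_nonneg (by rw [sub_nonneg, one_le_div hR]; exact hRT), sub_mul, one_mul,
      div_mul_cancel₀ _ hR.ne']
    nlinarith
  have d3 : dist (γ (T + h)) q ≤ 3 / 8 * δ := by
    rw [dist_eq_norm, ← planeToComplex.norm_map, map_sub]
    exact (norm_sub_le_norm_sub_add_norm_sub _ (((‖γ T‖ / R : ℝ) : ℂ) * planeToComplex q) _).trans
      (by linarith)
  -- Near `q`, energy is lost at rate at least `2 η` for a time `τ`.
  have hsol : IsSolutionOn φ γ (Icc (T + h) (T + h + τ)) := hγ.mono (hsub hs)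
  have hnear : ∀ u ∈ Icc (T + h) (T + h + τ), dist (γ u) q < δ := by
    intro u hu
    have e1 : ‖γ u - γ (T + h)‖ ≤ K * (u - (T + h)) :=
      norm_image_sub_le_of_norm_deriv_le_segment' hsol
        (fun v hv => hK v (hsub hs (Ico_subset_Icc_self hv))) u hu
    have e2 : K * (u - (T + h)) ≤ δ / 4 :=
      hτ ▸ mul_le_mul_of_nonneg_left (by linarith [hu.2]) hK0.le
    rw [← dist_eq_norm] at e1
    linarith [dist_triangle (γ u) (γ (T + h)) q]
  obtain ⟨u, hu, hslope⟩ := exists_hasDerivAt_eq_slope (fun u => ‖γ u‖ ^ 2)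
    (fun u => -2 * (γ u 1 ^ 2 * φ (γ u))) (lt_add_of_pos_right (T + h) hτ0)
    (fun u hu => (hsol.hasDerivWithinAt_norm_sq hu).continuousWithinAt)
    (fun u hu => (hsol.hasDerivWithinAt_norm_sq (Ioo_subset_Icc_self hu)).hasDerivAt
      (Icc_mem_nhds hu.1 hu.2))
  rw [add_sub_cancel_left, eq_div_iff hτ0.ne'] at hslope
  have hloss := mul_lt_mul_of_pos_right (hδq _ (hnear u (Ioo_subset_Icc_self hu))) hτ0
  have hTs : ‖γ (T + h)‖ ^ 2 ≤ ‖γ T‖ ^ 2 := hanti hT hs (by linarith)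
  have hend := hLle (T + h + τ) (by linarith)
  nlinarith [mul_pos hη0 hτ0]

end Dissipation

theorem lemma1 (φ : Plane → ℝ) (hφ : LocallyLipschitz φ)
    (U : Set Plane) (hU : Bornology.IsBounded U)
    (σ : ℝ) (hσ : σ = sSup ((fun p : Plane => dist p 0) '' U))
    (hnonneg : ∀ p, p ∉ U → 0 ≤ φ p)
    (hcirc : ∀ r, σ < r → ¬ VanishesOnCircle φ r)
    (p : Plane) :
    -- the solution starting at `p` exists for all `t ≥ 0` and is unique
    ∃ γ : ℝ → Plane, γ 0 = p ∧ IsSolutionOn φ γ (Set.Ici 0) ∧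
      (∀ (T : ℝ) (η : ℝ → Plane), η 0 = p → IsSolutionOn φ η (Set.Ico 0 T) →
        Set.EqOn η γ (Set.Ico 0 T)) ∧
      -- once in the disk of radius `σ`, it does not leave it
      (∀ t₀, 0 ≤ t₀ → γ t₀ ∈ disk σ → ∀ t, t₀ ≤ t → γ t ∈ disk σ) ∧
      -- it definitively enters every larger concentric disk
      (∀ ρ, σ < ρ → ∃ t₀, 0 ≤ t₀ ∧ ∀ t, t₀ ≤ t → γ t ∈ disk ρ) ∧
      -- it definitively enters the disk of radius `σ` itself, when the bounding circle
      -- is neither a point nor contained in the zero set of `φ`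
      (0 < σ → ¬ VanishesOnCircle φ σ → ∃ t₀, 0 ≤ t₀ ∧ ∀ t, t₀ ≤ t → γ t ∈ disk σ) := by
  have hσ0 : 0 ≤ σ := by
    rw [hσ]
    exact Real.sSup_nonneg (by rintro _ ⟨q, -, rfl⟩; exact dist_nonneg)
  have hext : ∀ q : Plane, σ < ‖q‖ → 0 ≤ φ q := by
    intro q hq
    refine hnonneg q fun hqU => hq.not_ge ?_
    obtain ⟨C, hC⟩ := hU.exists_norm_le
    rw [hσ, ← dist_zero_right]
    refine le_csSup ⟨C, ?_⟩ (mem_image_of_mem _ hqU)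
    rintro _ ⟨q', hq', rfl⟩
    simpa using hC q' hq'
  -- By continuity `φ ≥ 0` also on the circle of radius `σ`, parts of which may belong to `U`.
  have hext' : ∀ q : Plane, q ≠ 0 → σ ≤ ‖q‖ → 0 ≤ φ q := by
    intro q hq0 hq
    have hlim : Tendsto (fun θ : ℝ => φ ((1 + θ) • q)) (𝓝[>] 0) (𝓝 (φ q)) :=
      ((hφ.continuous.comp (by fun_prop : Continuous fun θ : ℝ => (1 + θ) • q)).tendsto' 0 _
        (by simp)).mono_left nhdsWithin_le_nhds
    refine ge_of_tendsto hlim (eventually_mem_nhdsWithin.mono fun θ hθ => hext _ ?_)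
    rw [norm_smul, Real.norm_eq_abs, abs_of_pos (by linarith [mem_Ioi.1 hθ])]
    nlinarith [mem_Ioi.1 hθ, norm_pos_iff.2 hq0]
  obtain ⟨γ, h0, hγ⟩ := exists_isSolutionOn_Ici hφ hext p
  have hstay : ∀ c, σ ≤ c → ∀ t₀, 0 ≤ t₀ → γ t₀ ∈ disk c → ∀ t, t₀ ≤ t → γ t ∈ disk c := by
    intro c hc t₀ ht₀ hin t ht
    simp only [disk, mem_ofPred_eq, dist_zero_right] at hin ⊢
    have hsol : IsSolutionOn φ γ (Icc t₀ t) := hγ.mono fun s hs => ht₀.trans hs.1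
    exact hsol.norm_le (hσ0.trans hc) (fun q hq0 hq => hext' q hq0 (hc.trans hq)) hin t
      (right_mem_Icc.2 ht)
  have henter : ∀ c, 0 < c → σ ≤ c → (∀ r, c ≤ r → ¬ VanishesOnCircle φ r) →
      ∃ t₀, 0 ≤ t₀ ∧ ∀ t, t₀ ≤ t → γ t ∈ disk c := by
    intro c hc hσc hvan
    obtain ⟨t₀, ht₀, hlt⟩ := hγ.exists_norm_lt hφ.continuous
      (locallyLipschitz_phiField hφ).continuous hc
      (fun q hq => hext' q (norm_pos_iff.1 (hc.trans_le hq)) (hσc.trans hq)) hvan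
    exact ⟨t₀, ht₀, hstay c hσc t₀ ht₀ (by simpa [disk] using hlt.le)⟩
  refine ⟨γ, h0, hγ, ?_, hstay σ le_rfl, ?_, ?_⟩
  · intro T η hη0 hη t ht
    exact eqOn_Icc_of_locallyLipschitz (locallyLipschitz_phiField hφ)
      (hη.mono (Icc_subset_Ico_right ht.2)) (hγ.mono fun s hs => hs.1) (hη0.trans h0.symm)
      (right_mem_Icc.2 ht.1)
  · exact fun ρ hρ => henter ρ (hσ0.trans_lt hρ) hρ.le fun r hr => hcirc r (hρ.trans_le hr)
  · intro hσpos hvan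
    refine henter σ hσpos le_rfl fun r hr => ?_
    rcases hr.eq_or_lt with rfl | hlt
    exacts [hvan, hcirc r hlt]
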